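/- Let $(W_t)_{t\ge 0}$ be a standard Wiener process (with $W_0=0$ and continuous paths, almost surely) on a probability space $(\Omega,\mathcal F,\mathbb P)$, and let $M_t=\sup_{0\le s\le t}W_s$ and $m_t=\inf_{0\le s\le t}W_s$ be its running maximum and running minimum. Let $\Phi$ be the distribution function of the standard normal law $N(0,1)$ and put $$\Psi(q,r,s)=\sum_{k=0}^{\infty}\bigl(\Phi(q-ks)-\Phi(q-r-ks)\bigr),$$ a series that converges for all real $q,r$ and all $s>0$. Then for every $t>0$ the joint distribution function $F_t(x,y,z)=\mathbb P(W_t\le x,\ M_t\le y,\ m_t\le z)$ of $(W_t,M_t,m_t)$ satisfies, for all real $x,y,z$, $$F_t(x,y,z)=F\left(\frac{x}{\sqrt t},\frac{y}{\sqrt t},\frac{z}{\sqrt t}\right),$$ where $$F(x,y,z)=\begin{cases} 0 & \text{for } y\le 0,\\ \Phi(x)-\Phi(x-2y) & \text{for } z\ge 0,\ 0<y,\ x<y,\\ 2\Phi(y)-1 & \text{for } z\ge 0,\ 0<y\le x,\\ \Phi(x)-\Phi(x-2y) & \text{for } x<z<0<y,\\ 2\Psi(z,2y,2(y-z))-\Psi(x+2z-2y,2y,2(y-z))-\Psi(-x+2z,2y,2(y-z))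 & \text{for } z<0<y,\ z\le x\le y,\\ 2\Psi(z,2y,2(y-z))-2\Psi(2z-y,2y,2(y-z)) & \text{for } z<0<y<x. \end{cases}$$ -/

import Mathlib

open MeasureTheory ProbabilityTheory Set
open scoped NNReal

namespace WienerExtrema

/-- The distribution function of the standard normal law. -/
noncomputable def Phi (x : ℝ) : ℝ := cdf (gaussianReal 0 1) x

/-- The `k`-th term of the series `Psi q r s`. -/
noncomputable def psiTerm (q r s : ℝ) (k : ℕ) : ℝ := Phi (q - k * s) - Phi (q - r - k * s)

/-- `Ψ(q, r, s) = ∑_{k ≥ 0} (Φ(q - k s) - Φ(q - r - k s))`. -/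
noncomputable def Psi (q r s : ℝ) : ℝ := ∑' k : ℕ, psiTerm q r s k

/-- The piecewise function `F(x, y, z)`. The six branches are, in order: `y ≤ 0`;
`z ≥ 0`, `0 < y`, `x < y`; `z ≥ 0`, `0 < y ≤ x`; `x < z < 0 < y`;
`z < 0 < y`, `z ≤ x ≤ y`; `z < 0 < y < x`. -/
noncomputable def F (x y z : ℝ) : ℝ :=
  if y ≤ 0 then 0
  else if 0 ≤ z then
    if x < y then Phi x - Phi (x - 2 * y)
    else 2 * Phi y - 1
  else if x < z then Phi x - Phi (x - 2 * y)
  else if x ≤ y then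
    2 * Psi z (2 * y) (2 * (y - z))
      - Psi (x + 2 * z - 2 * y) (2 * y) (2 * (y - z))
      - Psi (-x + 2 * z) (2 * y) (2 * (y - z))
  else
    2 * Psi z (2 * y) (2 * (y - z)) - 2 * Psi (2 * z - y) (2 * y) (2 * (y - z))

variable {Ω : Type*}

/-- The running maximum `M_t = sup {W_s : 0 ≤ s ≤ t}`. -/
noncomputable def runMax (W : ℝ≥0 → Ω → ℝ) (t : ℝ≥0) (ω : Ω) : ℝ :=
  sSup ((fun s => W s ω) '' Icc 0 t)

/-- The running minimum `m_t = inf {W_s : 0 ≤ s ≤ t}`. -/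
noncomputable def runMin (W : ℝ≥0 → Ω → ℝ) (t : ℝ≥0) (ω : Ω) : ℝ :=
  sInf ((fun s => W s ω) '' Icc 0 t)

/-- The joint distribution function of `(W_t, M_t, m_t)`: the mass that the joint law of the
triple gives to `(-∞, x] × (-∞, y] × (-∞, z]`. -/
noncomputable def jointCDF [MeasurableSpace Ω] (W : ℝ≥0 → Ω → ℝ) (P : Measure Ω) (t : ℝ≥0)
    (x y z : ℝ) : ℝ :=
  (P.map (fun ω => (W t ω, runMax W t ω, runMin W t ω))).real (Iic x ×ˢ Iic y ×ˢ Iic z)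

end WienerExtrema

/-! Everything rests on a reflection principle. Suppose a bounded `g` is odd about every zero of a
continuous `h` with `h 0 > 0`. When the path first leaves `{h > 0}` it sits at such a zero, and the
conditional mean of `g (W T)` from there vanishes by Gaussian symmetry. So only paths that never
leave contribute to the mean (`integral_eq_integral_mul_stayInd`). Instead of the strong Markov
property, the proof rounds the exit time up to a grid, uses independent increments at grid points,
and refines the mesh (`tendsto_gridSum`).

Taking `g` to be the indicator of a set minus that of its reflection yields the law of `W T` on
surviving paths (`measureReal_mem_and_stay`). For one barrier `y` the set is `Iic x`. For barriers
`z < y` it is `(z, x]` repeated with period `2 * (y - z)`, and the resulting bilateral series folds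
into `Psi` through `Phi (-x) = 1 - Phi x`.

For `y > 0` the joint distribution function is the one-barrier probability minus the two-barrier
one, since the running maximum has no atom at `y`. -/

namespace WienerExtrema

open Filter Topology

/-! ### Gaussian averages: symmetry and continuity. -/

section

/-- The average of `g` over a Gaussian law of variance `s` centred at `x`. -/
noncomputable def heat (g : ℝ → ℝ) (s : ℝ≥0) (x : ℝ) : ℝ :=
  ∫ w, g (x + w) ∂(gaussianReal 0 s)

/-- The centred Gaussian is invariant under `w ↦ -w`, which changes the sign of `g (c + w)`;
variance `0` is included. -/
lemma heat_eq_zero_of_antisymm {g : ℝ → ℝ} {c : ℝ} (hg : ∀ w, g (2 * c - w) = -g w)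
    (s : ℝ≥0) : heat g s c = 0 := by
  have h : heat g s c = - heat g s c := by
    conv_lhs => rw [heat]
    have hm : (gaussianReal 0 s).map (Homeomorph.neg ℝ) = gaussianReal 0 s :=
      (gaussianReal_map_neg (μ := 0) (v := s)).trans (by simp)
    conv_lhs => rw [← hm]
    rw [(Homeomorph.neg ℝ).measurableEmbedding.integral_map (μ := gaussianReal 0 s)
      (g := fun w => g (c + w)), heat, ← integral_neg]
    congr 1 with w
    rw [← hg]
    congr 1
    simp
    ring
  linarith

lemma abs_heat_le {g : ℝ → ℝ} {C : ℝ} (hC : ∀ w, |g w| ≤ C) (s : ℝ≥0) (x : ℝ) :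
    |heat g s x| ≤ C := by
  have := norm_integral_le_of_norm_le_const (μ := gaussianReal 0 s) (f := fun w => g (x + w))
    (C := C) (by filter_upwards with w using hC _)
  simpa [heat] using this

lemma measurable_heat {g : ℝ → ℝ} (hg : Measurable g) (s : ℝ≥0) : Measurable (heat g s) := by
  have : StronglyMeasurable (fun p : ℝ × ℝ => g (p.1 + p.2)) :=
    (hg.comp (measurable_fst.add measurable_snd)).stronglyMeasurable
  exact this.integral_prod_right.measurable

lemma heat_eq_integral_pdf (g : ℝ → ℝ) {s : ℝ≥0} (hs : s ≠ 0) (x : ℝ) :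
    heat g s x = ∫ w, gaussianPDFReal x s w * g w := by
  have hm : (gaussianReal 0 s).map (fun w => x + w) = gaussianReal x s := by
    simp [gaussianReal_map_const_add]
  have := (Homeomorph.addLeft x).measurableEmbedding.integral_map (μ := gaussianReal 0 s) (g := g)
  simp only [Homeomorph.coe_addLeft, hm] at this
  rw [heat, ← this, integral_gaussianReal_eq_integral_smul hs]
  simp

/-- An integrable majorant uniform in the centre and the variance, for dominated convergence. It
uses `s > s₀ / 2` in the prefactor, `s < 2 * s₀` in the exponent, and `(w - x) ^ 2 ≥ (w - x₀) ^ 2 /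
2 - 1`. -/
lemma gaussianPDFReal_le_of_near {x₀ x w : ℝ} {s₀ s : ℝ≥0} (h0 : 0 < s₀) (h1 : s₀ / 2 < s)
    (h2 : s < 2 * s₀) (hx : |x - x₀| < 1) :
    gaussianPDFReal x s w ≤
      (√(Real.pi * s₀))⁻¹ * (Real.exp (4 * s₀ : ℝ)⁻¹ * Real.exp (-(8 * s₀ : ℝ)⁻¹ * (w - x₀) ^ 2)) := by
  have h0' : (0 : ℝ) < s₀ := h0
  have h1' : (s₀ : ℝ) / 2 < s := by exact_mod_cast h1
  have h2' : (s : ℝ) < 2 * s₀ := by exact_mod_cast h2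
  have hs : (0 : ℝ) < s := by linarith
  rw [gaussianPDFReal, ← Real.exp_add]
  refine mul_le_mul (inv_anti₀ (Real.sqrt_pos.2 (by positivity)) (Real.sqrt_le_sqrt ?_))
    (Real.exp_le_exp.2 ?_) (Real.exp_pos _).le (by positivity)
  · have := Real.pi_pos
    nlinarith
  · have hx2 : (x - x₀) ^ 2 ≤ 1 := by
      rw [← sq_abs]; nlinarith [abs_nonneg (x - x₀)]
    have e1 : (w - x) ^ 2 / (4 * s₀) ≤ (w - x) ^ 2 / (2 * s) :=
      div_le_div_of_nonneg_left (sq_nonneg _) (by positivity) (by linarith)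
    have e2 : (w - x₀) ^ 2 / 2 - 1 ≤ (w - x) ^ 2 := by nlinarith [sq_nonneg (w - x - (x - x₀))]
    have e3 : ((w - x₀) ^ 2 / 2 - 1) / (4 * s₀) ≤ (w - x) ^ 2 / (4 * s₀) :=
      div_le_div_of_nonneg_right e2 (by positivity)
    have e4 : ((w - x₀) ^ 2 / 2 - 1) / (4 * s₀)
        = -((4 * s₀ : ℝ)⁻¹ + -(8 * s₀ : ℝ)⁻¹ * (w - x₀) ^ 2) := by field_simp; ring
    rw [neg_div]
    linarith

/-- Here `g` may jump, so continuity comes from the density, which is why the variance `s₀` must be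
positive. -/
lemma continuousAt_heat {g : ℝ → ℝ} {C : ℝ} (hg : Measurable g) (hC : ∀ w, |g w| ≤ C)
    {s₀ : ℝ≥0} (h0 : 0 < s₀) (x₀ : ℝ) :
    ContinuousAt (fun p : ℝ≥0 × ℝ => heat g p.1 p.2) (s₀, x₀) := by
  have hev : ∀ᶠ p : ℝ≥0 × ℝ in 𝓝 (s₀, x₀), (s₀ / 2 < p.1 ∧ p.1 < 2 * s₀) ∧ |p.2 - x₀| < 1 := by
    have ha : ∀ᶠ s : ℝ≥0 in 𝓝 s₀, s₀ / 2 < s ∧ s < 2 * s₀ :=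
      Ioo_mem_nhds (NNReal.half_lt_self h0.ne') (by
        have h0' : (0 : ℝ) < s₀ := h0
        rw [← NNReal.coe_lt_coe]; push_cast; linarith)
    have hb : ∀ᶠ x : ℝ in 𝓝 x₀, |x - x₀| < 1 := 
      Metric.ball_mem_nhds x₀ one_pos
    exact ha.prod_nhds hb
  have hcont : ContinuousAt (fun p : ℝ≥0 × ℝ => ∫ w, gaussianPDFReal p.2 p.1 w * g w) (s₀, x₀) := by
    refine continuousAt_of_dominated (bound := fun w => ((√(Real.pi * s₀))⁻¹ *
      (Real.exp (4 * s₀ : ℝ)⁻¹ * Real.exp (-(8 * s₀ : ℝ)⁻¹ * (w - x₀) ^ 2))) * C) ?_ ?_ ?_ ?_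
    · exact Eventually.of_forall fun p =>
        ((measurable_gaussianPDFReal _ _).mul hg).aestronglyMeasurable
    · filter_upwards [hev] with p hp
      filter_upwards with w
      rw [norm_mul, Real.norm_eq_abs, Real.norm_eq_abs, abs_of_nonneg (gaussianPDFReal_nonneg _ _ _)]
      have := gaussianPDFReal_le_of_near (w := w) h0 hp.1.1 hp.1.2 hp.2
      have := gaussianPDFReal_nonneg p.2 p.1 w
      gcongr
      exact hC w
    · have hb : (0 : ℝ) < (8 * s₀ : ℝ)⁻¹ := by positivity
      exact ((((integrable_exp_neg_mul_sq hb).comp_sub_right x₀).const_mul _).const_mul _).mul_const _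
    · filter_upwards with w
      have h0' : (s₀ : ℝ) ≠ 0 := by exact_mod_cast h0.ne'
      have h3 : √(2 * Real.pi * s₀) ≠ 0 := by positivity
      have h4 : (2 * (s₀ : ℝ)) ≠ 0 := by positivity
      unfold gaussianPDFReal
      refine ContinuousAt.mul (ContinuousAt.mul (ContinuousAt.inv₀ (by fun_prop) h3) ?_)
        continuousAt_const
      exact Real.continuous_exp.continuousAt.comp (ContinuousAt.div (by fun_prop) (by fun_prop) h4)
  refine hcont.congr ?_
  filter_upwards [hev] with p hp
  exact (heat_eq_integral_pdf g (ne_bot_of_gt hp.1.1) p.2).symm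

end

/-! ### Staying events, first exits and their grid approximation. -/

section

/-- By compactness, strict positivity is a uniform lower bound, a closed condition that need only be
tested on a dense sequence. This makes the staying event depend on countably many coordinates. -/
lemma forall_le_pos_iff_denseSeq {f : ℝ≥0 → ℝ} (hf : Continuous f) (r : ℝ≥0) :
    (∀ s ≤ r, 0 < f s) ↔
      ∃ n : ℕ, ∀ i : ℕ, 1 / ((n : ℝ) + 1) ≤ f (min (TopologicalSpace.denseSeq ℝ≥0 i) r) := by
  constructor
  · intro h
    obtain ⟨s, hs, hmin⟩ := (isCompact_Icc (a := (0 : ℝ≥0)) (b := r)).exists_isMinOn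
      ⟨0, by simp⟩ hf.continuousOn
    obtain ⟨n, hn⟩ := exists_nat_one_div_lt (h s hs.2)
    exact ⟨n, fun i => hn.le.trans (hmin ⟨zero_le, min_le_right _ _⟩)⟩
  · rintro ⟨n, hn⟩ s hs
    have hcl : IsClosed {s : ℝ≥0 | 1 / ((n : ℝ) + 1) ≤ f (min s r)} :=
      isClosed_le continuous_const (hf.comp (continuous_id.min continuous_const))
    have hall := (TopologicalSpace.denseRange_denseSeq ℝ≥0).induction_on
      (p := fun s => 1 / ((n : ℝ) + 1) ≤ f (min s r)) s hcl hn
    rw [min_eq_left hs] at hall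
    exact lt_of_lt_of_le (by positivity) hall

variable {Ω : Type*}

/-- The indicator of the event that `h (W s) > 0` for all `s ≤ r`. -/
noncomputable def stayInd (h : ℝ → ℝ) (W : ℝ≥0 → Ω → ℝ) (r : ℝ≥0) : Ω → ℝ :=
  {ω | ∀ s ≤ r, 0 < h (W s ω)}.indicator 1

lemma stayInd_nonneg (h : ℝ → ℝ) (W : ℝ≥0 → Ω → ℝ) (r : ℝ≥0) (ω : Ω) : 0 ≤ stayInd h W r ω :=
  indicator_nonneg (fun _ _ => zero_le_one) _

lemma stayInd_le_one (h : ℝ → ℝ) (W : ℝ≥0 → Ω → ℝ) (r : ℝ≥0) (ω : Ω) : stayInd h W r ω ≤ 1 :=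
  indicator_le_self' (fun _ _ => zero_le_one) _

lemma stayInd_antitone (h : ℝ → ℝ) (W : ℝ≥0 → Ω → ℝ) (ω : Ω) :
    Antitone (fun r => stayInd h W r ω) := fun _ _ hrs =>
  indicator_le_indicator_of_subset
    (ofPred_subset_ofPred.2 fun _ hω s (hs : s ≤ _) => hω s (hs.trans hrs)) (fun _ => zero_le_one) ω

lemma stayInd_of_forall {h : ℝ → ℝ} {W : ℝ≥0 → Ω → ℝ} {r : ℝ≥0} {ω : Ω}
    (H : ∀ s ≤ r, 0 < h (W s ω)) : stayInd h W r ω = 1 :=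
  indicator_of_mem (mem_ofPred.2 H) _

/-- The set of sequences bounded below by a positive constant after applying `h`. -/
def seqStay (h : ℝ → ℝ) : Set (ℕ → ℝ) := {x | ∃ n : ℕ, ∀ i, 1 / ((n : ℝ) + 1) ≤ h (x i)}

lemma measurableSet_seqStay {h : ℝ → ℝ} (hh : Continuous h) : MeasurableSet (seqStay h) := by
  have : seqStay h = ⋃ n : ℕ, ⋂ i : ℕ, {x : ℕ → ℝ | 1 / ((n : ℝ) + 1) ≤ h (x i)} := by
    ext x; simp [seqStay]
  rw [this]
  exact MeasurableSet.iUnion fun n => MeasurableSet.iInter fun i =>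
    measurableSet_le measurable_const (hh.measurable.comp (measurable_pi_apply i))

/-- The path sampled along a dense sequence of `[0, r]`. -/
noncomputable def sampled (W : ℝ≥0 → Ω → ℝ) (r : ℝ≥0) (ω : Ω) : ℕ → ℝ :=
  fun i => W (min (TopologicalSpace.denseSeq ℝ≥0 i) r) ω

variable {W : ℝ≥0 → Ω → ℝ}

/-- A continuous path starting in `{0 < f}` and not staying there up to `T` first leaves at a zero
of `f`. -/
lemma exists_first_zero {f : ℝ≥0 → ℝ} (hf : Continuous f) (h0 : 0 < f 0) {T : ℝ≥0}
    (hT : ¬ ∀ s ≤ T, 0 < f s) :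
    ∃ τ ≤ T, f τ = 0 ∧ ∀ r, (∀ s ≤ r, 0 < f s) ↔ r < τ := by
  push Not at hT
  obtain ⟨s₀, hs₀, hfs₀⟩ := hT
  have hcl : IsClosed {s | f s ≤ 0} := isClosed_le hf continuous_const
  have hne : {s | f s ≤ 0}.Nonempty := ⟨s₀, hfs₀⟩
  set τ := sInf {s | f s ≤ 0} with hτ
  have hmem : f τ ≤ 0 := hcl.csInf_mem hne (OrderBot.bddBelow _)
  have hle : ∀ s, f s ≤ 0 → τ ≤ s := fun s hs => csInf_le (OrderBot.bddBelow _) hs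
  have hlt : ∀ s < τ, 0 < f s := fun s hs => by
    by_contra hc
    exact absurd (hle s (not_lt.1 hc)) (not_le.2 hs)
  refine ⟨τ, (hle _ hfs₀).trans hs₀, le_antisymm hmem ?_, fun r => ⟨fun hr => ?_, fun hr s hs =>
    hlt s (hs.trans_lt hr)⟩⟩
  · have hτ0 : τ ≠ 0 := fun h => by rw [h] at hmem; linarith
    have hcl' : IsClosed {s | 0 ≤ f s} := isClosed_le continuous_const hf
    have : τ ∈ closure (Iio τ) := by
      rw [closure_Iio' ⟨0, pos_iff_ne_zero.2 hτ0⟩]; exact self_mem_Iic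
    exact hcl'.closure_subset_iff.2 (fun s hs => (hlt s hs).le) this
  · by_contra hc
    exact absurd (hr τ (not_lt.1 hc)) (not_lt.2 hmem)

/-- The `k`-th point of the grid of mesh `T / (n + 1)`. -/
noncomputable def gridPt (T : ℝ≥0) (n k : ℕ) : ℝ≥0 := T * (k / (n + 1 : ℕ))

lemma gridPt_mono (T : ℝ≥0) (n : ℕ) : Monotone (gridPt T n) := fun a b hab => by
  unfold gridPt; gcongr

lemma gridPt_zero (T : ℝ≥0) (n : ℕ) : gridPt T n 0 = 0 := by simp [gridPt]

lemma gridPt_last (T : ℝ≥0) (n : ℕ) : gridPt T n (n + 1) = T := by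
  simp [gridPt]

lemma gridPt_le (T : ℝ≥0) {n k : ℕ} (hk : k ≤ n + 1) : gridPt T n k ≤ T := by
  simpa [gridPt_last] using gridPt_mono T n hk

lemma gridPt_succ (T : ℝ≥0) (n k : ℕ) : gridPt T n (k + 1) = gridPt T n k + T / (n + 1 : ℕ) := by
  simp only [gridPt, div_eq_mul_inv]
  push_cast
  ring

/-- The average of `heat g (T - σ) (W σ)` over the exit event, `σ` being the time of exit from
`{h > 0}` rounded up to the grid of mesh `T / (n + 1)`. -/
noncomputable def gridSum (g h : ℝ → ℝ) (W : ℝ≥0 → Ω → ℝ) (T : ℝ≥0) (n : ℕ) (ω : Ω) : ℝ :=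
  ∑ k ∈ Finset.range (n + 1), heat g (T - gridPt T n (k + 1)) (W (gridPt T n (k + 1)) ω) *
    (stayInd h W (gridPt T n k) ω - stayInd h W (gridPt T n (k + 1)) ω)

/-- The weights are nonnegative and telescope to at most `1`. -/
lemma abs_gridSum_le {g h : ℝ → ℝ} {T : ℝ≥0} {n : ℕ} {ω : Ω} {ε : ℝ} (hε : 0 ≤ ε)
    (H : ∀ k < n + 1, stayInd h W (gridPt T n k) ω ≠ stayInd h W (gridPt T n (k + 1)) ω →
      |heat g (T - gridPt T n (k + 1)) (W (gridPt T n (k + 1)) ω)| ≤ ε) :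
    |gridSum g h W T n ω| ≤ ε := by
  calc |gridSum g h W T n ω|
      ≤ ∑ k ∈ Finset.range (n + 1), |heat g (T - gridPt T n (k + 1)) (W (gridPt T n (k + 1)) ω) *
        (stayInd h W (gridPt T n k) ω - stayInd h W (gridPt T n (k + 1)) ω)| :=
        Finset.abs_sum_le_sum_abs _ _
    _ ≤ ∑ k ∈ Finset.range (n + 1),
        ε * (stayInd h W (gridPt T n k) ω - stayInd h W (gridPt T n (k + 1)) ω) := by
        refine Finset.sum_le_sum fun k hk => ?_
        have hd : 0 ≤ stayInd h W (gridPt T n k) ω - stayInd h W (gridPt T n (k + 1)) ω :=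
          sub_nonneg.2 (stayInd_antitone h W ω (gridPt_mono T n k.le_succ))
        rw [abs_mul, abs_of_nonneg hd]
        by_cases he : stayInd h W (gridPt T n k) ω = stayInd h W (gridPt T n (k + 1)) ω
        · simp [he]
        · exact mul_le_mul_of_nonneg_right (H k (Finset.mem_range.1 hk) he) hd
    _ = ε * (stayInd h W (gridPt T n 0) ω - stayInd h W (gridPt T n (n + 1)) ω) := by
        rw [← Finset.mul_sum, Finset.sum_range_sub' (fun k => stayInd h W (gridPt T n k) ω)]
    _ ≤ ε * 1 := by
        gcongr
        linarith [stayInd_le_one h W (gridPt T n 0) ω, stayInd_nonneg h W (gridPt T n (n + 1)) ω]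
    _ = ε := mul_one ε

lemma tendsto_gridSum {g h : ℝ → ℝ} {C : ℝ} (hg : Measurable g) (hC : ∀ w, |g w| ≤ C)
    (hh : Continuous h) (hanti : ∀ c, h c = 0 → ∀ w, g (2 * c - w) = -g w) {T : ℝ≥0} {ω : Ω}
    (hω : Continuous (W · ω)) (h0 : 0 < h (W 0 ω)) :
    Tendsto (fun n => gridSum g h W T n ω) atTop (𝓝 0) := by
  have hf : Continuous (fun s => h (W s ω)) := hh.comp hω
  by_cases hT : ∀ s ≤ T, 0 < h (W s ω)
  · refine tendsto_const_nhds.congr fun n => ?_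
    have hone : ∀ k ≤ n + 1, stayInd h W (gridPt T n k) ω = 1 := fun k hk =>
      stayInd_of_forall fun s hs => hT s (hs.trans (gridPt_le T hk))
    refine (Finset.sum_eq_zero fun k hk => ?_).symm
    have := Finset.mem_range.1 hk
    rw [hone k (by omega), hone (k + 1) (by omega), sub_self, mul_zero]
  obtain ⟨τ, hτT, hτ0, hτ⟩ := exists_first_zero hf h0 hT
  have hzero : ∀ s, heat g s (W τ ω) = 0 := heat_eq_zero_of_antisymm (hanti _ hτ0)
  -- Only the cell containing the exit time `τ` carries weight.
  have hne : ∀ {n k : ℕ}, stayInd h W (gridPt T n k) ω ≠ stayInd h W (gridPt T n (k + 1)) ω →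
      gridPt T n k < τ ∧ τ ≤ gridPt T n (k + 1) := fun {n k} hk => by
    by_contra hc
    refine hk ?_
    simp only [stayInd, indicator, mem_ofPred_eq, hτ]
    have := gridPt_mono T n k.le_succ
    have : gridPt T n k < τ ↔ gridPt T n (k + 1) < τ := by
      constructor
      · intro h1
        by_contra h2
        exact hc ⟨h1, not_lt.1 h2⟩
      · exact fun h1 => this.trans_lt h1
    simp only [this]
  -- Continuity of `heat` needs `T - τ > 0`. If `τ = T`, the only admissible `s` is `T`, where the
  -- value is exactly `0`.
  have hev : ∀ ε > 0, ∃ δ > (0 : ℝ≥0), ∀ s ≤ T, τ ≤ s → s < τ + δ →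
      |heat g (T - s) (W s ω)| ≤ ε := fun ε hε => by
    rcases hτT.eq_or_lt with rfl | hlt
    · refine ⟨1, one_pos, fun s hs1 hs2 _ => ?_⟩
      rw [le_antisymm hs1 hs2, hzero, abs_zero]
      exact hε.le
    · have hcont : ContinuousAt (fun s => heat g (T - s) (W s ω)) τ :=
        (continuousAt_heat hg hC (tsub_pos_of_lt hlt) (W τ ω)).comp
          (f := fun s : ℝ≥0 => (T - s, W s ω))
          ((continuous_const.sub continuous_id).prodMk hω).continuousAt
      obtain ⟨δ, hδ, H⟩ := Metric.continuousAt_iff.1 hcont ε hε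
      refine ⟨⟨δ, hδ.le⟩, hδ, fun s _ hs2 hs3 => ?_⟩
      have hd : dist s τ < δ := by
        have a1 : (τ : ℝ) ≤ s := hs2
        have a2 : (s : ℝ) < τ + δ := hs3
        rw [NNReal.dist_eq, abs_of_nonneg (by linarith)]
        linarith
      have := H hd
      rw [hzero, Real.dist_eq, sub_zero] at this
      exact this.le
  rw [Metric.tendsto_atTop]
  intro ε hε
  obtain ⟨δ, hδ, H⟩ := hev (ε / 2) (half_pos hε)
  obtain ⟨N, hN⟩ := exists_nat_gt (T / δ)
  refine ⟨N, fun n hn => ?_⟩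
  rw [Real.dist_eq, sub_zero]
  refine (abs_gridSum_le (half_pos hε).le fun k hk hk' => ?_).trans_lt (half_lt_self hε)
  obtain ⟨h1, h2⟩ := hne hk'
  refine H _ (gridPt_le T hk) h2 ?_
  rw [gridPt_succ]
  refine add_lt_add_of_lt_of_le h1 ?_
  rw [div_le_iff₀ (by positivity)]
  rw [div_lt_iff₀ hδ] at hN
  refine hN.le.trans ?_
  rw [mul_comm]
  gcongr
  exact hn.trans n.le_succ

/-! ### The Markov property and the reflection principle. -/

variable [MeasurableSpace Ω] {P : Measure Ω}

lemma stayInd_ae_eq {h : ℝ → ℝ} (hh : Continuous h) (hW : IsBrownianReal W P) (r : ℝ≥0) :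
    stayInd h W r =ᵐ[P] fun ω => (seqStay h).indicator 1 (sampled W r ω) := by
  filter_upwards [hW.cont] with ω hω
  have := forall_le_pos_iff_denseSeq (hh.comp hω) r
  have hiff : ω ∈ {ω | ∀ s ≤ r, 0 < h (W s ω)} ↔ sampled W r ω ∈ seqStay h := this
  by_cases hm : sampled W r ω ∈ seqStay h
  · rw [stayInd, indicator_of_mem (hiff.2 hm), indicator_of_mem hm]; rfl
  · rw [stayInd, indicator_of_notMem (mt hiff.1 hm), indicator_of_notMem hm]

lemma aemeasurable_stayInd {h : ℝ → ℝ} (hh : Continuous h) (hW : IsBrownianReal W P) (r : ℝ≥0) :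
    AEMeasurable (stayInd h W r) P := by
  refine AEMeasurable.congr ?_ (stayInd_ae_eq hh hW r).symm
  have h1 : AEMeasurable (sampled W r) P := aemeasurable_pi_lambda _ fun i => hW.aemeasurable _
  exact (measurable_one.indicator (measurableSet_seqStay hh)).comp_aemeasurable h1

/-- The Markov property of Brownian motion at time `r`, for the event of staying in `{h > 0}` up
to an earlier time. -/
lemma integral_mul_stayInd [IsProbabilityMeasure P] (hW : IsBrownianReal W P) {g h : ℝ → ℝ}
    {C : ℝ} (hg : Measurable g) (hC : ∀ w, |g w| ≤ C) (hh : Continuous h) {r' r T : ℝ≥0}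
    (h1 : r' ≤ r) (h2 : r ≤ T) :
    ∫ ω, g (W T ω) * stayInd h W r' ω ∂P
      = ∫ ω, heat g (T - r) (W r ω) * stayInd h W r' ω ∂P := by
  -- `X` is a function of the path up to `r`, hence independent of the later increment `Z`; Fubini
  -- then averages over `Z` alone.
  set Z : Ω → ℝ := fun ω => W T ω - W r ω with hZ
  set X : Ω → ℝ × (ℕ → ℝ) := fun ω => (W r ω, sampled W r' ω) with hX
  have hXm : AEMeasurable X P :=
    (hW.aemeasurable _).prodMk (aemeasurable_pi_lambda _ fun i => hW.aemeasurable _)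
  have hZlaw : HasLaw Z (gaussianReal 0 (T - r)) P := by
    have := (hW.shift r).hasLaw_eval (T - r)
    rwa [add_tsub_cancel_of_le h2] at this
  have hind : IndepFun X Z P := by
    have hr (i : ℕ) : min (TopologicalSpace.denseSeq ℝ≥0 i) r' ∈ Iic r :=
      (min_le_right _ _).trans h1
    have hψ : Measurable (fun f : Iic r → ℝ => (f ⟨r, self_mem_Iic⟩, fun i : ℕ => f ⟨_, hr i⟩)) :=
      (measurable_pi_iff.1 measurable_id _).prodMk
        (measurable_pi_iff.2 fun i => measurable_pi_iff.1 measurable_id _)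
    have hφ : Measurable (fun f : ℝ≥0 → ℝ => f (T - r)) := measurable_pi_iff.1 measurable_id _
    have h3 := (hW.indepFun_shift r).comp hφ hψ
    have h4 : (fun f : ℝ≥0 → ℝ => f (T - r)) ∘ (fun ω t => W (r + t) ω - W r ω) = Z := by
      funext ω
      simp [hZ, add_tsub_cancel_of_le h2]
    rw [h4] at h3
    exact h3.symm
  set q : (ℝ × (ℕ → ℝ)) → ℝ := fun x => (seqStay h).indicator 1 x.2 with hq
  have hqm : Measurable q :=
    (measurable_one.indicator (measurableSet_seqStay hh)).comp measurable_snd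
  have hq1 : ∀ x, |q x| ≤ 1 := fun x => by
    simp only [hq, indicator]; split_ifs <;> simp
  have hmap := hind.map_prod_eq_prod_map_map hXm hZlaw.aemeasurable
  rw [hZlaw.map_eq] at hmap
  have : IsProbabilityMeasure (P.map X) := Measure.isProbabilityMeasure_map hXm
  have hC0 : 0 ≤ C := (abs_nonneg _).trans (hC 0)
  have hGm : Measurable (fun p : (ℝ × (ℕ → ℝ)) × ℝ => g (p.1.1 + p.2) * q p.1) :=
    (hg.comp (by fun_prop)).mul (hqm.comp measurable_fst)
  calc ∫ ω, g (W T ω) * stayInd h W r' ω ∂P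
      = ∫ ω, (fun p : (ℝ × (ℕ → ℝ)) × ℝ => g (p.1.1 + p.2) * q p.1) (X ω, Z ω) ∂P := by
        refine integral_congr_ae ?_
        filter_upwards [stayInd_ae_eq hh hW r'] with ω hω
        simp [hω, hX, hZ, hq]
    _ = ∫ p, g (p.1.1 + p.2) * q p.1 ∂((P.map X).prod (gaussianReal 0 (T - r))) := by
        rw [← hmap, integral_map (hXm.prodMk hZlaw.aemeasurable) hGm.aestronglyMeasurable]
    _ = ∫ x, ∫ z, g (x.1 + z) * q x ∂(gaussianReal 0 (T - r)) ∂(P.map X) := by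
        rw [integral_prod]
        refine Integrable.of_bound hGm.aestronglyMeasurable C (ae_of_all _ fun p => ?_)
        rw [Real.norm_eq_abs, abs_mul]
        exact (mul_le_mul (hC _) (hq1 _) (abs_nonneg _) hC0).trans (mul_one C).le
    _ = ∫ x, heat g (T - r) x.1 * q x ∂(P.map X) := by
        simp only [integral_mul_const, heat]
    _ = ∫ ω, heat g (T - r) (W r ω) * stayInd h W r' ω ∂P := by
        have hm : Measurable (fun x : ℝ × (ℕ → ℝ) => heat g (T - r) x.1 * q x) :=
          ((measurable_heat hg _).comp measurable_fst).mul hqm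
        rw [integral_map hXm hm.aestronglyMeasurable]
        refine integral_congr_ae ?_
        filter_upwards [stayInd_ae_eq hh hW r'] with ω hω
        simp [hω, hX, hq]

/-- The reflection principle: if `g` is antisymmetric about every boundary point of `{h > 0}`, only
the paths that stay in `{h > 0}` contribute to the mean of `g (W T)`. -/
theorem integral_eq_integral_mul_stayInd [IsProbabilityMeasure P] (hW : IsBrownianReal W P)
    {g h : ℝ → ℝ} {C : ℝ} (hg : Measurable g) (hC : ∀ w, |g w| ≤ C) (hh : Continuous h)
    (h0 : 0 < h 0) (hanti : ∀ c, h c = 0 → ∀ w, g (2 * c - w) = -g w) (T : ℝ≥0) :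
    ∫ ω, g (W T ω) ∂P = ∫ ω, g (W T ω) * stayInd h W T ω ∂P := by
  have hC0 : 0 ≤ C := (abs_nonneg _).trans (hC 0)
  have hint : ∀ (f : ℝ → ℝ) (_ : Measurable f) (_ : ∀ w, |f w| ≤ C) (s r : ℝ≥0),
      Integrable (fun ω => f (W s ω) * stayInd h W r ω) P := fun f hf hfC s r => by
    refine Integrable.of_bound ((hf.comp_aemeasurable (hW.aemeasurable s)).mul
      (aemeasurable_stayInd hh hW r)).aestronglyMeasurable C (ae_of_all _ fun ω => ?_)
    rw [Real.norm_eq_abs, abs_mul, abs_of_nonneg (stayInd_nonneg _ _ _ _)]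
    exact (mul_le_mul (hfC _) (stayInd_le_one _ _ _ _) (stayInd_nonneg _ _ _ _) hC0).trans
      (mul_one C).le
  -- The Markov property at the right end of each cell, for staying up to either end, replaces
  -- `heat` by `g (W T)`; the sum then telescopes.
  have hkey : ∀ n, ∫ ω, gridSum g h W T n ω ∂P
      = ∫ ω, g (W T ω) * stayInd h W 0 ω ∂P - ∫ ω, g (W T ω) * stayInd h W T ω ∂P := fun n => by
    simp only [gridSum, mul_sub]
    rw [integral_finsetSum _ fun k _ => by
      exact (hint _ (measurable_heat hg _) (abs_heat_le hC _) _ _).sub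
        (hint _ (measurable_heat hg _) (abs_heat_le hC _) _ _)]
    have : ∀ k ∈ Finset.range (n + 1), ∫ ω, (heat g (T - gridPt T n (k + 1))
          (W (gridPt T n (k + 1)) ω) * stayInd h W (gridPt T n k) ω
        - heat g (T - gridPt T n (k + 1)) (W (gridPt T n (k + 1)) ω) *
          stayInd h W (gridPt T n (k + 1)) ω) ∂P
        = ∫ ω, g (W T ω) * stayInd h W (gridPt T n k) ω ∂P
          - ∫ ω, g (W T ω) * stayInd h W (gridPt T n (k + 1)) ω ∂P := fun k hk => by
      have hkT : gridPt T n (k + 1) ≤ T := gridPt_le T (Finset.mem_range.1 hk)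
      rw [integral_sub (hint _ (measurable_heat hg _) (abs_heat_le hC _) _ _)
        (hint _ (measurable_heat hg _) (abs_heat_le hC _) _ _),
        integral_mul_stayInd hW hg hC hh (gridPt_mono T n k.le_succ) hkT,
        integral_mul_stayInd hW hg hC hh le_rfl hkT]
    rw [Finset.sum_congr rfl this, Finset.sum_range_sub'
      (fun k => ∫ ω, g (W T ω) * stayInd h W (gridPt T n k) ω ∂P), gridPt_zero, gridPt_last]
  have hlim : Tendsto (fun n => ∫ ω, gridSum g h W T n ω ∂P) atTop (𝓝 (∫ _, 0 ∂P)) := by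
    refine tendsto_integral_of_dominated_convergence (fun _ => C) (fun n => ?_)
      (integrable_const C) (fun n => ?_) ?_
    · unfold gridSum
      simp only [mul_sub]
      exact (integrable_finsetSum _ fun k _ =>
        (hint _ (measurable_heat hg _) (abs_heat_le hC _) _ _).sub
        (hint _ (measurable_heat hg _) (abs_heat_le hC _) _ _)).aestronglyMeasurable
    · exact ae_of_all _ fun ω => abs_gridSum_le hC0 fun k _ _ => abs_heat_le hC _ _
    · filter_upwards [hW.cont, hW.eval_zero_ae_eq_zero] with ω hω hω0
      exact tendsto_gridSum hg hC hh hanti hω (by rwa [hω0])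
  simp only [hkey, integral_zero] at hlim
  have hlim' := tendsto_nhds_unique tendsto_const_nhds hlim
  have hstart : ∫ ω, g (W T ω) * stayInd h W 0 ω ∂P = ∫ ω, g (W T ω) ∂P := by
    refine integral_congr_ae ?_
    filter_upwards [hW.eval_zero_ae_eq_zero] with ω hω
    have : stayInd h W 0 ω = 1 := stayInd_of_forall fun s hs => by
      rw [le_antisymm hs zero_le, hω]; exact h0
    rw [this, mul_one]
  linarith

end

/-! ### The normal distribution function and the series `Psi`. -/

section

lemma Phi_eq_real (x : ℝ) : Phi x = (gaussianReal 0 1).real (Iic x) := cdf_eq_real _ x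

lemma Phi_nonneg (x : ℝ) : 0 ≤ Phi x := cdf_nonneg _ x

lemma continuous_Phi : Continuous Phi := by
  have : NullSingletonClass (gaussianReal 0 1) := nullSingletonClass_gaussianReal one_ne_zero
  have h : ∀ x, ContinuousAt (cdf (gaussianReal 0 1)) x := fun x => by
    rw [(monotone_cdf _).continuousAt_iff_leftLim_eq_rightLim, StieltjesFunction.rightLim_eq]
    have h1 := (cdf (gaussianReal 0 1)).measure_singleton x
    rw [measure_cdf, measure_singleton, eq_comm, ENNReal.ofReal_eq_zero] at h1
    exact le_antisymm ((monotone_cdf _).leftLim_le le_rfl) (by linarith)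
  exact continuous_iff_continuousAt.2 h

lemma gaussianReal_real_preimage_neg (T : ℝ≥0) {A : Set ℝ} (hA : MeasurableSet A) :
    (gaussianReal 0 T).real ((fun w => -w) ⁻¹' A) = (gaussianReal 0 T).real A := by
  rw [← map_measureReal_apply measurable_neg hA, gaussianReal_map_neg, neg_zero]

lemma gaussianReal_real_Iic {T : ℝ≥0} (hT : 0 < T) (x : ℝ) :
    (gaussianReal 0 T).real (Iic x) = Phi (x / √T) := by
  have hT' : (0 : ℝ) < √T := Real.sqrt_pos.2 hT
  have hm : (gaussianReal 0 1).map (√(T : ℝ) * ·) = gaussianReal 0 T := by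
    rw [gaussianReal_map_const_mul]
    congr 1
    · simp
    · ext; simp
  rw [← hm, map_measureReal_apply (measurable_const_mul _) measurableSet_Iic, Phi_eq_real]
  congr 1
  ext w
  simp [le_div_iff₀ hT', mul_comm]

lemma gaussianReal_real_Ioc {T : ℝ≥0} (hT : 0 < T) {a b : ℝ} (hab : a ≤ b) :
    (gaussianReal 0 T).real (Ioc a b) = Phi (b / √T) - Phi (a / √T) := by
  rw [← gaussianReal_real_Iic hT, ← gaussianReal_real_Iic hT, ← Iic_sdiff_Iic,
    measureReal_sdiff (Iic_subset_Iic.2 hab) measurableSet_Iic]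

lemma Phi_neg (x : ℝ) : Phi (-x) = 1 - Phi x := by
  have : NullSingletonClass (gaussianReal 0 1) := nullSingletonClass_gaussianReal one_ne_zero
  rw [Phi_eq_real, Phi_eq_real, ← gaussianReal_real_preimage_neg 1 measurableSet_Iic,
    ← probReal_compl_eq_one_sub measurableSet_Iic]
  have : (fun w : ℝ => -w) ⁻¹' Iic (-x) = Ici x := by ext; simp
  rw [this, compl_Iic]
  exact (measureReal_congr Ioi_ae_eq_Ici).symm

/-- Chernoff's bound with parameter `-1`; this crude decay already gives a geometric majorant for
the series. -/
lemma Phi_le_exp (x : ℝ) : Phi x ≤ Real.exp (x + 1 / 2) := by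
  have h := measure_le_le_exp_mul_mgf (μ := gaussianReal 0 1) (X := id) (t := -1) x (by norm_num)
    (integrable_exp_mul_gaussianReal (-1))
  rw [mgf_id_gaussianReal, ← Real.exp_add] at h
  rw [Phi_eq_real]
  refine h.trans (le_of_eq ?_)
  congr 1
  norm_num

lemma summable_Phi_sub_mul (q : ℝ) {s : ℝ} (hs : 0 < s) :
    Summable (fun k : ℕ => Phi (q - k * s)) := by
  have hgeo : Summable (fun k : ℕ => Real.exp (q + 1 / 2) * Real.exp (-s) ^ k) :=
    (summable_geometric_of_lt_one (Real.exp_pos _).le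
      (by simpa using hs)).mul_left _
  refine hgeo.of_nonneg_of_le (fun k => Phi_nonneg _) fun k => (Phi_le_exp _).trans (le_of_eq ?_)
  rw [← Real.exp_nat_mul, ← Real.exp_add]
  congr 1
  ring

lemma summable_psiTerm (q r : ℝ) {s : ℝ} (hs : 0 < s) : Summable (psiTerm q r s) :=
  (summable_Phi_sub_mul q hs).sub (summable_Phi_sub_mul (q - r) hs)

lemma Psi_eq_add (q r : ℝ) {s : ℝ} (hs : 0 < s) :
    Psi q r s = (Phi q - Phi (q - r)) + Psi (q - s) r s := by
  rw [Psi, (summable_psiTerm q r hs).tsum_eq_zero_add, Psi]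
  congr 1
  · simp [psiTerm]
  · refine tsum_congr fun k => ?_
    simp only [psiTerm]
    push_cast
    ring_nf

/-- The bilateral sum of `Phi q - Phi (q - 2 y)` over the progression `q ∈ x + 2 (y - z) ℤ`. -/
lemma hasSum_int_Phi_sub (x : ℝ) {y z : ℝ} (hzy : z < y) :
    HasSum (fun k : ℤ => Phi (x + k * (2 * (y - z))) - Phi (x + k * (2 * (y - z)) - 2 * y))
      (Phi x - Phi (x - 2 * y) + Psi (2 * z - x) (2 * y) (2 * (y - z))
        + Psi (x - 2 * (y - z)) (2 * y) (2 * (y - z))) := by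
  have hs : 0 < 2 * (y - z) := by linarith
  have h1 : HasSum (fun n : ℕ => Phi (x + ((n : ℤ) : ℝ) * (2 * (y - z)))
      - Phi (x + ((n : ℤ) : ℝ) * (2 * (y - z)) - 2 * y))
      (Phi x - Phi (x - 2 * y) + Psi (2 * z - x) (2 * y) (2 * (y - z))) := by
    have h := (summable_psiTerm (2 * z - x) (2 * y) hs).hasSum
    -- The positive indices run towards `+∞`; `Phi_neg` turns them into a series of the form `Psi`.
    -- The shift by one leaves index `0` as a separate term.
    have hfun : psiTerm (2 * z - x) (2 * y) (2 * (y - z)) = fun n : ℕ =>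
        Phi (x + (((n + 1 : ℕ) : ℤ) : ℝ) * (2 * (y - z)))
          - Phi (x + (((n + 1 : ℕ) : ℤ) : ℝ) * (2 * (y - z)) - 2 * y) := by
      funext n
      have e1 : x + (((n + 1 : ℕ) : ℤ) : ℝ) * (2 * (y - z))
          = -(2 * z - x - 2 * y - n * (2 * (y - z))) := by push_cast; ring
      have e2 : x + (((n + 1 : ℕ) : ℤ) : ℝ) * (2 * (y - z)) - 2 * y
          = -(2 * z - x - n * (2 * (y - z))) := by push_cast; ring
      rw [e2, e1, Phi_neg, Phi_neg, psiTerm]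
      ring
    rw [← Psi, hfun] at h
    have h' := (hasSum_nat_add_iff (f := fun n : ℕ => Phi (x + ((n : ℤ) : ℝ) * (2 * (y - z)))
      - Phi (x + ((n : ℤ) : ℝ) * (2 * (y - z)) - 2 * y)) 1).1 h
    simpa [add_comm] using h'
  have h2 := (summable_psiTerm (x - 2 * (y - z)) (2 * y) hs).hasSum
  have hfun : psiTerm (x - 2 * (y - z)) (2 * y) (2 * (y - z)) = fun n : ℕ =>
      Phi (x + ((-((n : ℤ) + 1) : ℤ) : ℝ) * (2 * (y - z)))
        - Phi (x + ((-((n : ℤ) + 1) : ℤ) : ℝ) * (2 * (y - z)) - 2 * y) := by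
    funext n
    simp only [psiTerm]
    push_cast
    ring_nf
  rw [← Psi, hfun] at h2
  exact HasSum.of_nat_of_neg_add_one h1 h2

/-! ### Reflection for sets. -/

variable {Ω : Type*} [MeasurableSpace Ω] {P : Measure Ω} {W : ℝ≥0 → Ω → ℝ}

lemma nullMeasurableSet_stay {h : ℝ → ℝ} (hh : Continuous h) (hW : IsBrownianReal W P) (r : ℝ≥0) :
    NullMeasurableSet {ω | ∀ s ≤ r, 0 < h (W s ω)} P := by
  have h1 := (aemeasurable_stayInd hh hW r).nullMeasurableSet_preimage (measurableSet_singleton 1)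
  convert h1 using 1
  ext ω
  simp [stayInd, indicator]

/-- The reflection principle for a set `A` whose reflections about the boundary points of
`{h > 0}` all agree. -/
lemma measureReal_mem_and_stay [IsProbabilityMeasure P] (hW : IsBrownianReal W P) {h : ℝ → ℝ}
    (hh : Continuous h) (h0 : 0 < h 0) {A : Set ℝ} (hA : MeasurableSet A) {c : ℝ}
    (hanti : ∀ c', h c' = 0 → ∀ w, 2 * c' - w ∈ A ↔ 2 * c - w ∈ A)
    (hdisj : ∀ w, 0 < h w → 2 * c - w ∉ A) (T : ℝ≥0) :
    P.real {ω | W T ω ∈ A ∧ ∀ s ≤ T, 0 < h (W s ω)}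
      = (gaussianReal 0 T).real A - (gaussianReal 0 T).real {w | 2 * c + w ∈ A} := by
  set f : ℝ → ℝ := A.indicator (fun _ => 1) with hf
  have hfm : Measurable f := measurable_const.indicator hA
  have hf0 : ∀ w, 0 ≤ f w := fun w => indicator_nonneg (fun _ _ => zero_le_one) _
  have hf1 : ∀ w, f w ≤ 1 := fun w => indicator_le_self' (fun _ _ => zero_le_one) _
  have hcongr : ∀ {u v : ℝ}, (u ∈ A ↔ v ∈ A) → f u = f v := fun {u v} huv => by
    by_cases hv : v ∈ A
    · rw [hf, indicator_of_mem hv, indicator_of_mem (huv.2 hv)]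
    · rw [hf, indicator_of_notMem hv, indicator_of_notMem (mt huv.1 hv)]
  set g : ℝ → ℝ := fun w => f w - f (2 * c - w) with hg
  have hgm : Measurable g := hfm.sub (hfm.comp (measurable_const.sub measurable_id))
  have hg1 : ∀ w, |g w| ≤ 1 := fun w => abs_le.2
    ⟨by linarith [hf0 w, hf1 (2 * c - w)], by linarith [hf1 w, hf0 (2 * c - w)]⟩
  -- Since all boundary reflections of `A` agree, the single centre `c` makes `g` odd about each
  -- zero `c'`.
  have hmain := integral_eq_integral_mul_stayInd hW hgm hg1 hh h0 (fun c' hc' w => by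
    have e1 := hcongr (hanti c' hc' w)
    have e2 := hcongr (hanti c' hc' (2 * c' - w))
    rw [sub_sub_cancel] at e2
    simp only [hg, e1, e2]
    ring) T
  have hleft : ∫ ω, g (W T ω) ∂P
      = (gaussianReal 0 T).real A - (gaussianReal 0 T).real {w | 2 * c + w ∈ A} := by
    have hB : MeasurableSet {w : ℝ | 2 * c + w ∈ A} := measurable_const.add measurable_id hA
    have e1 : ∫ w, f w ∂(gaussianReal 0 T) = (gaussianReal 0 T).real A := integral_indicator_one hA
    have e2 : ∫ w, f (2 * c - w) ∂(gaussianReal 0 T)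
        = (gaussianReal 0 T).real {w | 2 * c + w ∈ A} := by
      rw [← gaussianReal_real_preimage_neg T hB, ← integral_indicator_one (measurable_neg hB)]
      rfl
    have hint : ∀ f' : ℝ → ℝ, Measurable f' → (∀ w, 0 ≤ f' w) → (∀ w, f' w ≤ 1) →
        Integrable f' (gaussianReal 0 T) := fun f' hm h0 h1 =>
      Integrable.of_bound hm.aestronglyMeasurable 1 (ae_of_all _ fun w => by
        rw [Real.norm_eq_abs, abs_of_nonneg (h0 w)]; exact h1 w)
    refine ((hW.hasLaw_eval T).integral_comp hgm.aestronglyMeasurable).trans ?_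
    have hint' := hint (fun w => f (2 * c - w)) (hfm.comp (measurable_const.sub measurable_id))
      (fun w => hf0 _) (fun w => hf1 _)
    rw [hg, integral_sub (hint _ hfm hf0 hf1) hint', e1, e2]
  have hright : ∫ ω, g (W T ω) * stayInd h W T ω ∂P
      = P.real {ω | W T ω ∈ A ∧ ∀ s ≤ T, 0 < h (W s ω)} := by
    have hnull : NullMeasurableSet {ω | W T ω ∈ A ∧ ∀ s ≤ T, 0 < h (W s ω)} P :=
      ((hW.aemeasurable T).nullMeasurableSet_preimage hA).inter (nullMeasurableSet_stay hh hW T)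
    have : (fun ω => g (W T ω) * stayInd h W T ω)
        = {ω | W T ω ∈ A ∧ ∀ s ≤ T, 0 < h (W s ω)}.indicator (fun _ => (1 : ℝ)) := by
      funext ω
      by_cases hs : ∀ s ≤ T, 0 < h (W s ω)
      -- On surviving paths the reflected term vanishes, so `g` reduces to the indicator of `A`.
      · have hz : f (2 * c - W T ω) = 0 := indicator_of_notMem (hdisj _ (hs T le_rfl)) _
        simp only [hg, hz, sub_zero, stayInd_of_forall hs, mul_one]
        by_cases hmem : W T ω ∈ A
        · rw [hf, indicator_of_mem hmem, indicator_of_mem (mem_ofPred.2 ⟨hmem, hs⟩)]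
        · rw [hf, indicator_of_notMem hmem, indicator_of_notMem fun H => hmem (mem_ofPred.1 H).1]
      · simp [stayInd, hs]
    rw [this, integral_indicator₀ hnull, setIntegral_const, smul_eq_mul, mul_one]
  rw [← hright, ← hmain, hleft]

end

/-! ### Running extrema and the one-barrier law. -/

section

variable {Ω : Type*} {W : ℝ≥0 → Ω → ℝ}

lemma runMax_eq_iSup {ω : Ω} (hω : Continuous (W · ω)) (t : ℝ≥0) :
    runMax W t ω = ⨆ i : ℕ, W (min (TopologicalSpace.denseSeq ℝ≥0 i) t) ω := by
  have hc : Continuous (fun s => W (min s t) ω) := hω.comp (continuous_id.min continuous_const)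
  have himg : (fun s => W s ω) '' Icc 0 t = range (fun s => W (min s t) ω) := by
    ext v
    simp only [mem_image, mem_Icc, mem_range]
    exact ⟨fun ⟨s, hs, hv⟩ => ⟨s, by rw [min_eq_left hs.2, hv]⟩,
      fun ⟨s, hv⟩ => ⟨min s t, ⟨zero_le, min_le_right _ _⟩, hv⟩⟩
  have h := (TopologicalSpace.denseRange_denseSeq ℝ≥0).ciSup' hc
  rw [runMax, himg, sSup_range, ← h]
  exact Set.rangeFactorization_surjective.iSup_comp (g := fun s : range
    (TopologicalSpace.denseSeq ℝ≥0) => W (min (s : ℝ≥0) t) ω) |>.symm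

lemma runMin_eq_neg_runMax (W : ℝ≥0 → Ω → ℝ) (t : ℝ≥0) (ω : Ω) :
    runMin W t ω = - runMax (-W) t ω := by
  rw [runMin, runMax, Real.sInf_def, ← image_neg_eq_neg, image_image]
  rfl

lemma runMax_le_iff {ω : Ω} (hω : Continuous (W · ω)) (t : ℝ≥0) (y : ℝ) :
    runMax W t ω ≤ y ↔ ∀ s ≤ t, W s ω ≤ y := by
  rw [runMax, csSup_le_iff (isCompact_Icc.image hω).bddAbove ((nonempty_Icc.2 zero_le).image _)]
  simp

lemma runMin_le_iff {ω : Ω} (hω : Continuous (W · ω)) (t : ℝ≥0) (z : ℝ) :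
    runMin W t ω ≤ z ↔ ¬ ∀ s ≤ t, z < W s ω := by
  rw [← not_lt, not_iff_not, runMin,
    isCompact_Icc.lt_sInf_iff_of_continuous (nonempty_Icc.2 zero_le) hω.continuousOn]
  simp

variable [MeasurableSpace Ω] {P : Measure Ω}

/-- The law of `W T` restricted to the paths that stay below `y`. -/
lemma measureReal_le_and_lt [IsProbabilityMeasure P] (hW : IsBrownianReal W P) {T : ℝ≥0}
    (hT : 0 < T) {x y : ℝ} (hy : 0 < y) (hxy : x ≤ y) :
    P.real {ω | W T ω ≤ x ∧ ∀ s ≤ T, W s ω < y}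
      = Phi (x / √T) - Phi (x / √T - 2 * (y / √T)) := by
  have h := measureReal_mem_and_stay hW (h := fun w => y - w) (by fun_prop) (by simpa using hy)
    (measurableSet_Iic (a := x)) (c := y) (fun c' hc' w => by rw [sub_eq_zero.1 hc'])
    (fun w hw => by simp only [mem_Iic, not_le]; linarith) T
  simp only [sub_pos, mem_Iic] at h
  rw [h, gaussianReal_real_Iic hT]
  have : {w : ℝ | 2 * y + w ≤ x} = Iic (x - 2 * y) := by
    ext w; simp only [mem_ofPred_eq, mem_Iic]; constructor <;> intro <;> linarith
  rw [this, gaussianReal_real_Iic hT]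
  congr 2
  ring

/-! ### The two-barrier law. -/

/-- The union of the translates of `(z, x]` by the multiples of `s`. -/
def periodicIoc (z x s : ℝ) : Set ℝ := ⋃ k : ℤ, Ioc (z + k * s) (x + k * s)

lemma mem_periodicIoc {z x s w : ℝ} :
    w ∈ periodicIoc z x s ↔ ∃ k : ℤ, z + k * s < w ∧ w ≤ x + k * s := by
  simp [periodicIoc]

lemma measurableSet_periodicIoc (z x s : ℝ) : MeasurableSet (periodicIoc z x s) :=
  MeasurableSet.iUnion fun _ => measurableSet_Ioc

/-- Reflecting in `z` and then in `y` translates by `2 * (y - z)`. With that as `s`, periodicity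
makes the two reflections of the set coincide. -/
lemma add_period_mem_periodicIoc {z x s w : ℝ} :
    w + s ∈ periodicIoc z x s ↔ w ∈ periodicIoc z x s := by
  simp only [mem_periodicIoc]
  constructor
  · rintro ⟨k, h1, h2⟩
    refine ⟨k - 1, ?_, ?_⟩ <;> push_cast <;> linarith
  · rintro ⟨k, h1, h2⟩
    refine ⟨k + 1, ?_, ?_⟩ <;> push_cast <;> linarith

lemma hasSum_gaussianReal_periodicIoc {T : ℝ≥0} (hT : 0 < T) {z x s : ℝ} (hs : 0 < s)
    (hzx : z ≤ x) (hxs : x ≤ z + s) :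
    HasSum (fun k : ℤ => Phi ((x + k * s) / √T) - Phi ((z + k * s) / √T))
      ((gaussianReal 0 T).real (periodicIoc z x s)) := by
  have hd : Pairwise (Function.onFun Disjoint fun k : ℤ => Ioc (z + k * s) (x + k * s)) := by
    refine (pairwise_disjoint_on _).2 fun m n hmn => ?_
    rw [Ioc_disjoint_Ioc]
    have : ((m : ℝ) + 1) * s ≤ n * s := by
      have : (m : ℝ) + 1 ≤ n := by exact_mod_cast hmn
      gcongr
    exact (min_le_left _ _).trans (le_trans (by linarith) (le_max_right _ _))
  have h := hasSum_integral_iUnion (μ := gaussianReal 0 T) (f := fun _ => (1 : ℝ))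
    (fun k : ℤ => measurableSet_Ioc) hd (integrable_const _).integrableOn
  simp only [setIntegral_const, smul_eq_mul, mul_one] at h
  have hfun : (fun k : ℤ => Phi ((x + k * s) / √T) - Phi ((z + k * s) / √T))
      = fun k : ℤ => (gaussianReal 0 T).real (Ioc (z + k * s) (x + k * s)) :=
    funext fun k => (gaussianReal_real_Ioc hT (by linarith)).symm
  rw [hfun]
  exact h

/-- The law of `W T` restricted to the paths that stay in `(z, y)`. -/
lemma measureReal_le_and_mem_Ioo [IsProbabilityMeasure P] (hW : IsBrownianReal W P) {T : ℝ≥0}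
    (hT : 0 < T) {x y z : ℝ} (hy : 0 < y) (hz : z < 0) (hzx : z ≤ x) (hxy : x ≤ y) :
    P.real {ω | W T ω ≤ x ∧ ∀ s ≤ T, z < W s ω ∧ W s ω < y}
      = (Phi (x / √T) - Phi (x / √T - 2 * (y / √T)))
        - (2 * Psi (z / √T) (2 * (y / √T)) (2 * (y / √T - z / √T))
          - Psi (x / √T + 2 * (z / √T) - 2 * (y / √T)) (2 * (y / √T)) (2 * (y / √T - z / √T))
          - Psi (-(x / √T) + 2 * (z / √T)) (2 * (y / √T)) (2 * (y / √T - z / √T))) := by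
  set d := 2 * (y - z) with hd
  have hd0 : 0 < d := by linarith
  have hT' : (0 : ℝ) < √T := Real.sqrt_pos.2 hT
  have h := measureReal_mem_and_stay hW (h := fun w => min (w - z) (y - w)) (by fun_prop)
    (by simp [hy, hz]) (measurableSet_periodicIoc z x d) (c := y) (fun c' hc' w => by
      rcases min_choice (c' - z) (y - c') with h1 | h1
      · have : c' = z := by simp only [h1] at hc'; linarith
        rw [← add_period_mem_periodicIoc, this]
        congr! 1
        rw [hd]; ring
      · have : c' = y := by simp only [h1] at hc'; linarith
        rw [this])
    -- For `w` in `(z, y)` the reflection `2 * y - w` lies in `(y, z + d)`, the gap after block `0`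
    -- and before block `1`.
    (fun w hw => by
      rw [lt_min_iff] at hw
      rw [mem_periodicIoc]
      rintro ⟨k, h1, h2⟩
      rcases le_or_gt k 0 with hk | hk
      · have : (k : ℝ) * d ≤ 0 := mul_nonpos_of_nonpos_of_nonneg (by exact_mod_cast hk) hd0.le
        linarith
      · have : d ≤ k * d := le_mul_of_one_le_left hd0.le (by exact_mod_cast hk)
        linarith) T
  have hset : {ω | W T ω ≤ x ∧ ∀ s ≤ T, z < W s ω ∧ W s ω < y}
      = {ω | W T ω ∈ periodicIoc z x d ∧ ∀ s ≤ T, 0 < min (W s ω - z) (y - W s ω)} := by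
    ext ω
    simp only [mem_ofPred_eq, lt_min_iff, sub_pos]
    -- Inside `(z, y)` only block `0` of the periodic set is met.
    refine and_congr_left fun hs => ?_
    obtain ⟨h1, h2⟩ := hs T le_rfl
    rw [mem_periodicIoc]
    constructor
    · intro hx
      exact ⟨0, by simpa using h1, by simpa using hx⟩
    · rintro ⟨k, h3, h4⟩
      rcases le_or_gt k 0 with hk | hk
      · have : (k : ℝ) * d ≤ 0 := mul_nonpos_of_nonpos_of_nonneg (by exact_mod_cast hk) hd0.le
        linarith
      · have : d ≤ k * d := le_mul_of_one_le_left hd0.le (by exact_mod_cast hk)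
        linarith
  have hrefl : {w | 2 * y + w ∈ periodicIoc z x d} = periodicIoc (z - 2 * y) (x - 2 * y) d := by
    ext w
    simp only [mem_ofPred_eq, mem_periodicIoc]
    refine exists_congr fun k => and_congr ?_ ?_ <;> constructor <;> intro <;> linarith
  rw [hset, h, hrefl]
  have s1 := (hasSum_gaussianReal_periodicIoc hT hd0 hzx (by linarith)).sub
    (hasSum_gaussianReal_periodicIoc hT hd0 (z := z - 2 * y) (x := x - 2 * y) (by linarith)
      (by linarith))
  have hzy : z / √T < y / √T := by gcongr; linarith
  have s2 := (hasSum_int_Phi_sub (x / √T) hzy).sub (hasSum_int_Phi_sub (z / √T) hzy)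
  have hfun : (fun k : ℤ => Phi ((x + k * d) / √T) - Phi ((z + k * d) / √T)
        - (Phi ((x - 2 * y + k * d) / √T) - Phi ((z - 2 * y + k * d) / √T)))
      = fun k : ℤ => Phi (x / √T + k * (2 * (y / √T - z / √T)))
          - Phi (x / √T + k * (2 * (y / √T - z / √T)) - 2 * (y / √T))
        - (Phi (z / √T + k * (2 * (y / √T - z / √T)))
          - Phi (z / √T + k * (2 * (y / √T - z / √T)) - 2 * (y / √T))) := by
    funext k
    rw [show ∀ a b c e : ℝ, a - b - (c - e) = a - c - (b - e) by intros; ring]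
    congr 3 <;> rw [hd] <;> ring
  rw [hfun] at s1
  rw [s1.unique s2]
  -- Peeling off the leading term merges the three contributions of the endpoint `z` into `2 * Psi`.
  have hPsi := Psi_eq_add (z / √T) (2 * (y / √T)) (s := 2 * (y / √T - z / √T)) (by linarith)
  rw [show x / √T + 2 * (z / √T) - 2 * (y / √T) = x / √T - 2 * (y / √T - z / √T) by ring,
    show -(x / √T) + 2 * (z / √T) = 2 * (z / √T) - x / √T by ring,
    show 2 * (z / √T) - z / √T = z / √T by ring]
  linarith

/-! ### Degenerate cases, atoms, and the joint distribution function. -/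

lemma measureReal_le_and_lt_of_le {T : ℝ≥0} {x y : ℝ} (hyx : y ≤ x) :
    P.real {ω | W T ω ≤ x ∧ ∀ s ≤ T, W s ω < y} = P.real {ω | ∀ s ≤ T, W s ω < y} := by
  congr 1
  ext ω
  simp only [mem_ofPred_eq]
  exact ⟨fun hs => hs.2, fun hs => ⟨(hs T le_rfl).le.trans hyx, hs⟩⟩

lemma measureReal_stay_gt_of_nonneg (hW : IsBrownianReal W P) {T : ℝ≥0} {x y z : ℝ} (hz : 0 ≤ z) :
    P.real {ω | W T ω ≤ x ∧ ∀ s ≤ T, z < W s ω ∧ W s ω < y} = 0 := by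
  have h0 : P {ω | W T ω ≤ x ∧ ∀ s ≤ T, z < W s ω ∧ W s ω < y} = 0 := by
    rw [measure_eq_zero_iff_ae_notMem]
    filter_upwards [hW.eval_zero_ae_eq_zero] with ω hω hmem
    have := ((mem_ofPred.1 hmem).2 0 zero_le).1
    linarith
  rw [measureReal_def, h0, ENNReal.toReal_zero]

lemma measureReal_forall_lt [IsProbabilityMeasure P] (hW : IsBrownianReal W P) {T : ℝ≥0}
    (hT : 0 < T) {y : ℝ} (hy : 0 < y) :
    P.real {ω | ∀ s ≤ T, W s ω < y} = 2 * Phi (y / √T) - 1 := by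
  have h := measureReal_le_and_lt hW hT hy le_rfl
  rw [show y / √T - 2 * (y / √T) = -(y / √T) by ring, Phi_neg] at h
  rw [measureReal_le_and_lt_of_le le_rfl] at h
  rw [h]
  ring

/-- Staying `≤ y` implies staying `< y + ε`; let `ε` decrease to `0`. The case `y = 0` shows that
the path immediately becomes positive, and `y > 0` excludes atoms of the maximum. -/
lemma measureReal_forall_le_le [IsProbabilityMeasure P] (hW : IsBrownianReal W P) {T : ℝ≥0}
    (hT : 0 < T) {y : ℝ} (hy : 0 ≤ y) :
    P.real {ω | ∀ s ≤ T, W s ω ≤ y} ≤ 2 * Phi (y / √T) - 1 := by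
  have hlim : Tendsto (fun ε => 2 * Phi ((y + ε) / √T) - 1) (𝓝[>] 0)
      (𝓝 (2 * Phi ((y + 0) / √T) - 1)) := by
    have : Continuous (fun ε : ℝ => 2 * Phi ((y + ε) / √T) - 1) := by
      have := continuous_Phi
      fun_prop
    exact this.continuousAt.continuousWithinAt
  rw [add_zero] at hlim
  refine ge_of_tendsto hlim ?_
  filter_upwards [self_mem_nhdsWithin] with ε (hε : 0 < ε)
  rw [← measureReal_forall_lt hW hT (by linarith)]
  exact measureReal_mono (ofPred_subset_ofPred.2 fun ω hω s hs => by linarith [hω s hs])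

lemma Phi_zero : Phi 0 = 1 / 2 := by
  have := Phi_neg 0
  rw [neg_zero] at this
  linarith

lemma ae_not_forall_le [IsProbabilityMeasure P] (hW : IsBrownianReal W P) {T : ℝ≥0}
    (hT : 0 < T) {y : ℝ} (hy : y ≤ 0) : ∀ᵐ ω ∂P, ¬ ∀ s ≤ T, W s ω ≤ y := by
  have h := measureReal_forall_le_le hW hT le_rfl
  rw [zero_div, Phi_zero] at h
  have h0 : P.real {ω | ∀ s ≤ T, W s ω ≤ y} = 0 := by
    refine le_antisymm ((measureReal_mono (ofPred_subset_ofPred.2 fun ω hω s hs =>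
      (hω s hs).trans hy)).trans (h.trans (by norm_num))) measureReal_nonneg
  rw [measureReal_eq_zero_iff] at h0
  rw [ae_iff]
  simpa using h0

lemma nullMeasurableSet_forall_lt (hW : IsBrownianReal W P) (T : ℝ≥0) (y : ℝ) :
    NullMeasurableSet {ω | ∀ s ≤ T, W s ω < y} P := by
  simpa only [sub_pos] using
    nullMeasurableSet_stay (h := fun w => y - w) (by fun_prop) hW T

lemma nullMeasurableSet_forall_gt (hW : IsBrownianReal W P) (T : ℝ≥0) (z : ℝ) :
    NullMeasurableSet {ω | ∀ s ≤ T, z < W s ω} P := by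
  simpa only [sub_pos] using
    nullMeasurableSet_stay (h := fun w => w - z) (by fun_prop) hW T

/-- The running maximum has no atom. -/
lemma ae_forall_le_iff_forall_lt [IsProbabilityMeasure P] (hW : IsBrownianReal W P) {T : ℝ≥0}
    (hT : 0 < T) {y : ℝ} (hy : 0 < y) :
    ∀ᵐ ω ∂P, (∀ s ≤ T, W s ω ≤ y) ↔ ∀ s ≤ T, W s ω < y := by
  have h1 := measureReal_forall_le_le hW hT hy.le
  rw [← measureReal_forall_lt hW hT hy] at h1
  have hsub : {ω | ∀ s ≤ T, W s ω < y} ⊆ {ω | ∀ s ≤ T, W s ω ≤ y} :=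
    ofPred_subset_ofPred.2 fun ω hω s hs => (hω s hs).le
  have hae := ae_eq_of_subset_of_measure_ge hsub
    ((ENNReal.toReal_le_toReal (measure_ne_top _ _) (measure_ne_top _ _)).1 h1)
    (nullMeasurableSet_forall_lt hW T y) (measure_ne_top _ _)
  filter_upwards [hae.mem_iff] with ω hω
  exact hω.symm

lemma aemeasurable_runMax (hW : IsBrownianReal W P) (t : ℝ≥0) : AEMeasurable (runMax W t) P := by
  refine (AEMeasurable.iSup fun i => hW.aemeasurable _).congr
    (f := fun ω => ⨆ i : ℕ, W (min (TopologicalSpace.denseSeq ℝ≥0 i) t) ω) ?_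
  filter_upwards [hW.cont] with ω hω
  exact (runMax_eq_iSup hω t).symm

lemma aemeasurable_runMin (hW : IsBrownianReal W P) (t : ℝ≥0) : AEMeasurable (runMin W t) P := by
  have : runMin W t = fun ω => - runMax (-W) t ω := funext (runMin_eq_neg_runMax W t)
  rw [this]
  exact (aemeasurable_runMax hW.neg t).neg

lemma jointCDF_eq (hW : IsBrownianReal W P) (t : ℝ≥0) (x y z : ℝ) :
    jointCDF W P t x y z
      = P.real {ω | W t ω ≤ x ∧ (∀ s ≤ t, W s ω ≤ y) ∧ ¬ ∀ s ≤ t, z < W s ω} := by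
  rw [jointCDF, map_measureReal_apply_of_aemeasurable
    ((hW.aemeasurable t).prodMk ((aemeasurable_runMax hW t).prodMk (aemeasurable_runMin hW t)))
    (measurableSet_Iic.prod (measurableSet_Iic.prod measurableSet_Iic))]
  refine measureReal_congr (Filter.eventuallyEq_set.2 ?_)
  filter_upwards [hW.cont] with ω hω
  simp only [mem_preimage, mem_prod, mem_Iic, runMax_le_iff hω, runMin_le_iff hω]

lemma jointCDF_eq_of_pos [IsProbabilityMeasure P] (hW : IsBrownianReal W P) {t : ℝ≥0}
    (ht : 0 < t) (x : ℝ) {y : ℝ} (hy : 0 < y) (z : ℝ) :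
    jointCDF W P t x y z = P.real {ω | W t ω ≤ x ∧ ∀ s ≤ t, W s ω < y}
      - P.real {ω | W t ω ≤ x ∧ ∀ s ≤ t, z < W s ω ∧ W s ω < y} := by
  have hnull : NullMeasurableSet {ω | W t ω ≤ x ∧ ∀ s ≤ t, z < W s ω ∧ W s ω < y} P := by
    have := ((hW.aemeasurable t).nullMeasurableSet_preimage (measurableSet_Iic (a := x))).inter
      ((nullMeasurableSet_forall_gt hW t z).inter (nullMeasurableSet_forall_lt hW t y))
    convert this using 1
    ext ω
    simp only [mem_ofPred_eq, mem_inter_iff, mem_preimage, mem_Iic, ← forall_and]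
  have hsub : {ω | W t ω ≤ x ∧ ∀ s ≤ t, z < W s ω ∧ W s ω < y}
      ⊆ {ω | W t ω ≤ x ∧ ∀ s ≤ t, W s ω < y} :=
    ofPred_subset_ofPred.2 fun ω hω => ⟨hω.1, fun s hs => (hω.2 s hs).2⟩
  rw [jointCDF_eq hW, measureReal_def, measureReal_def, measureReal_def,
    ← ENNReal.toReal_sub_of_le (measure_mono hsub) (measure_ne_top _ _),
    ← measure_sdiff hsub hnull (measure_ne_top _ _), ← measureReal_def, ← measureReal_def]
  refine measureReal_congr (Filter.eventuallyEq_set.2 ?_)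
  filter_upwards [ae_forall_le_iff_forall_lt hW ht hy] with ω hω
  simp only [mem_ofPred_eq, Set.mem_sdiff, hω, forall_and]
  tauto

theorem jointCDF_eq_F [IsProbabilityMeasure P] (hW : IsBrownianReal W P) {t : ℝ≥0} (ht : 0 < t)
    (x y z : ℝ) :
    jointCDF W P t x y z = F (x / √(t : ℝ)) (y / √(t : ℝ)) (z / √(t : ℝ)) := by
  have hσ : (0 : ℝ) < √t := Real.sqrt_pos.2 ht
  have hz : 0 ≤ z / √(t : ℝ) ↔ 0 ≤ z := by rw [le_div_iff₀ hσ, zero_mul]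
  have hy : y / √(t : ℝ) ≤ 0 ↔ y ≤ 0 := by rw [div_le_iff₀ hσ, zero_mul]
  simp only [F, hz, hy, div_lt_div_iff_of_pos_right hσ, div_le_div_iff_of_pos_right hσ]
  split_ifs with h1 h2 h3 h4 h5
  · rw [jointCDF_eq hW, measureReal_eq_zero_iff, measure_eq_zero_iff_ae_notMem]
    filter_upwards [ae_not_forall_le hW ht h1] with ω hω hmem
    exact hω (mem_ofPred.1 hmem).2.1
  all_goals
    rw [not_le] at h1
    rw [jointCDF_eq_of_pos hW ht x h1]
  · rw [measureReal_stay_gt_of_nonneg hW h2, measureReal_le_and_lt hW ht h1 h3.le, sub_zero]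
  · rw [measureReal_stay_gt_of_nonneg hW h2, measureReal_le_and_lt_of_le (not_lt.1 h3),
      measureReal_forall_lt hW ht h1, sub_zero]
  · have hempty : {ω | W t ω ≤ x ∧ ∀ s ≤ t, z < W s ω ∧ W s ω < y} = ∅ := by
      ext ω
      simp only [mem_ofPred_eq, mem_empty_iff_false, iff_false, not_and]
      intro hx hs
      linarith [(hs t le_rfl).1]
    rw [hempty, measureReal_empty, sub_zero,
      measureReal_le_and_lt hW ht h1 (by linarith)]
  · rw [measureReal_le_and_lt hW ht h1 h5,
      measureReal_le_and_mem_Ioo hW ht h1 (not_le.1 h2) (not_lt.1 h4) h5]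
    ring
  -- Staying below `y < x` makes the constraint at `x` void, so this case is the previous one at `x
  -- = y`, where two of the `Psi` terms coincide.
  · have hset : {ω | W t ω ≤ x ∧ ∀ s ≤ t, z < W s ω ∧ W s ω < y}
        = {ω | W t ω ≤ y ∧ ∀ s ≤ t, z < W s ω ∧ W s ω < y} := by
      ext ω
      simp only [mem_ofPred_eq]
      refine and_congr_left fun hs => ?_
      have := (hs t le_rfl).2
      constructor <;> intro <;> linarith
    rw [hset, measureReal_le_and_lt_of_le (not_le.1 h5).le,
      ← measureReal_le_and_lt_of_le le_rfl, measureReal_le_and_lt hW ht h1 le_rfl,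
      measureReal_le_and_mem_Ioo hW ht h1 (not_le.1 h2) (by linarith) le_rfl,
      show y / √(t : ℝ) + 2 * (z / √(t : ℝ)) - 2 * (y / √(t : ℝ))
        = 2 * (z / √(t : ℝ)) - y / √(t : ℝ) by ring,
      show -(y / √(t : ℝ)) + 2 * (z / √(t : ℝ)) = 2 * (z / √(t : ℝ)) - y / √(t : ℝ) by ring]
    ring

end

end WienerExtrema

theorem theorem1 {Ω : Type*} [MeasurableSpace Ω] (P : Measure Ω) [IsProbabilityMeasure P]
    (W : ℝ≥0 → Ω → ℝ) (hW : IsBrownianReal W P) :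
    (∀ q r s : ℝ, 0 < s → Summable (WienerExtrema.psiTerm q r s)) ∧
    ∀ t : ℝ≥0, 0 < t →
      AEMeasurable (fun ω => (W t ω, WienerExtrema.runMax W t ω, WienerExtrema.runMin W t ω)) P ∧
      ∀ x y z : ℝ,
        WienerExtrema.jointCDF W P t x y z =
          WienerExtrema.F (x / √(t : ℝ)) (y / √(t : ℝ)) (z / √(t : ℝ)) := by
  exact ⟨fun q r s hs => WienerExtrema.summable_psiTerm q r hs, fun t ht =>
    ⟨(hW.aemeasurable t).prodMk ((WienerExtrema.aemeasurable_runMax hW t).prodMk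
      (WienerExtrema.aemeasurable_runMin hW t)), WienerExtrema.jointCDF_eq_F hW ht⟩⟩
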